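/- All spaces are Hausdorff. A compactification of a space $X$ is a compact Hausdorff space $Y$ with an embedding $X\hookrightarrow Y$ as a dense subspace. A covering $\pi:\widetilde X\to X$ is a *covering with compactification* if there are compactifications $X\hookrightarrow Y$, $\widetilde X\hookrightarrow\widetilde Y$ and a covering $\overline\pi:\widetilde Y\to Y$ with $\overline\pi|_{\widetilde X}=\pi$. A covering $\pi$ with finite fibres is called *regular* here if some finite group of covering transformations of $\pi$ (homeomorphisms $f$ of $\widetilde X$ with $\pi\circ f=\pi$) acts transitively on every fibre of $\pi$; if $X$ is connected, this means that the group of all covering transformations is transitive on every fibre. A *unital noncommutative finite-fold covering* $(B,\widetilde B,G)$ consists of an injective $*$-homomorphism $B\hookrightarrow\widetilde B$ of unital $C^*$-algebras and an action of a finite group $G$ on $\widetilde B$ by $*$-automorphisms, in which every nontrivial $g\in G$ acts nontrivially, such that $B=\widetilde B^G$ and $\widetilde B$, with the product $\langle a,b\rangle=\sum_{g\in G}g(a^*b)$, is a finitely generated projective Hilbert $B$-module. A triple $(A,\widetilde A,G)$, with an inclusion $A\hookrightarrow\widetilde A$ of $C^*$-algebras, is a *noncommutative finite-fold covering with compactification*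 if there are a unital noncommutative finite-fold covering $(B,\widetilde B,G)$ and inclusions $A\subset B$, $\widetilde A\subset\widetilde B$, compatible with $A\hookrightarrow\widetilde A$ and $B\hookrightarrow\widetilde B$, such that $A$ is an essential ideal of $B$, $\widetilde A$ is an essential ideal of $\widetilde B$, $A=B\cap\widetilde A$, and $G\widetilde A=\widetilde A$. **Lemma.** Let $X$, $\widetilde X$ be locally compact Hausdorff spaces and let $\pi:\widetilde X\to X$ be a surjective continuous map. The following conditions are equivalent: (i) $\pi$ is a regular finite-fold covering with compactification; (ii) $f\mapsto f\circ\pi$ maps $C_0(X)$ into $C_0(\widetilde X)$, and there is a finite group $G$ such that $(C_0(X),C_0(\widetilde X),G)$, with this inclusion, is a noncommutative finite-fold covering with compactification. -/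

import Mathlib

open scoped ZeroAtInfty

universe u v

/-! ## Topological side -/

/-- The group of covering transformations of a map `π : X' → X`: all self-homeomorphisms `f` of
`X'` with `π ∘ f = π`. -/
def coveringGroup {X : Type u} {X' : Type v} [TopologicalSpace X'] (π : X' → X) :
    Subgroup (X' ≃ₜ X') where
  carrier := {f | ∀ x, π (f x) = π x}
  mul_mem' {f g} hf hg x := (hf (g x)).trans (hg x)
  one_mem' _ := rfl
  inv_mem' {f} hf x := by
    have h := hf (f⁻¹ x)
    rw [← h]
    exact congrArg π (f.apply_symm_apply x)

/-- `e : X → Y` is a compactification of `X`: the space `Y` is compact Hausdorff, `e` is a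
homeomorphism onto its image, and this image is dense in `Y`. -/
structure IsCompactification {X Y : Type u} [TopologicalSpace X] [TopologicalSpace Y]
    (e : X → Y) : Prop where
  compactSpace : CompactSpace Y
  t2Space : T2Space Y
  isEmbedding : Topology.IsEmbedding e
  denseRange : DenseRange e

/-- `π : X' → X` is a covering with compactification: it is a covering, and there are
compactifications `e : X → Y`, `e' : X' → Y'` and a covering `πbar : Y' → Y` whose restriction
to `X'` is `π`. (Up to homeomorphism, every compactification of a space lives in the universe of
that space.) -/
def IsCoveringWithCompactification {X : Type u} {X' : Type v} [TopologicalSpace X]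
    [TopologicalSpace X'] (π : X' → X) : Prop :=
  IsCoveringMap π ∧
    ∃ (Y : Type u) (_ : TopologicalSpace Y) (Y' : Type v) (_ : TopologicalSpace Y')
      (e : X → Y) (e' : X' → Y') (πbar : Y' → Y),
      IsCompactification e ∧ IsCompactification e' ∧ IsCoveringMap πbar ∧
        ∀ x, πbar (e' x) = e (π x)

/-- `π : X' → X` is a regular finite-fold covering with compactification: it is a covering with
compactification, its fibres are finite, and some finite group of covering transformations acts
transitively on every fibre. (If `X` is connected, this transitivity says exactly that the whole
group of covering transformations is transitive on the fibres, as that group is then finite.) -/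
structure IsRegularFiniteFoldCoveringWithCompactification {X : Type u} {X' : Type v}
    [TopologicalSpace X] [TopologicalSpace X'] (π : X' → X) : Prop where
  withCompactification : IsCoveringWithCompactification π
  finite_fiber : ∀ x, (π ⁻¹' {x}).Finite
  regular : ∃ H : Subgroup (X' ≃ₜ X'), H ≤ coveringGroup π ∧ Finite H ∧
    ∀ x y, π x = π y → ∃ h ∈ H, h x = y

/-! ## Algebraic side -/

/-- The right `B`-module structure on `B'` given by a homomorphism `ι : B → B'`:
`x • b = x * ι b`. -/
abbrev rightModule {B : Type u} {B' : Type v} [CStarAlgebra B] [CStarAlgebra B']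
    (ι : B →⋆ₐ[ℂ] B') : Module Bᵐᵒᵖ B' :=
  Module.compHom B' (RingHom.op (ι : B →+* B'))

/-- The triple `(B, B', G)` is a unital noncommutative finite-fold covering. Here `ι : B → B'` is
the injective *-homomorphism of unital C*-algebras and `ρ` is the action of the finite group `G` on
`B'` by *-automorphisms; it is non-degenerate, its fixed-point algebra is (the image of) `B`, and
`B'` is a finitely generated projective right `B`-module.

Since `G` is finite and `B` is the fixed-point algebra, the sum `∑ g, g (a⋆ b)` always lies in `B`,
and it makes `B'` a Hilbert `B`-module, with a norm equivalent to that of `B'`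
(`a⋆ a ≤ ∑ g, g (a⋆ a)`); so the product is no additional datum or condition, and a Hilbert module
over a unital C*-algebra is finitely generated projective exactly when its underlying
module is. -/
structure IsUnitalNCFiniteFoldCovering {B : Type u} {B' : Type v} [CStarAlgebra B]
    [CStarAlgebra B'] (ι : B →⋆ₐ[ℂ] B') {G : Type v} [Group G] (ρ : G →* (B' ≃⋆ₐ[ℂ] B')) :
    Prop where
  injective : Function.Injective ι
  finite : Finite G
  nondegenerate : ∀ g : G, g ≠ 1 → ∃ b : B', ρ g b ≠ b
  mem_range_iff_fixed : ∀ b : B', b ∈ Set.range ι ↔ ∀ g : G, ρ g b = b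
  finitelyGenerated : letI := rightModule ι; Module.Finite Bᵐᵒᵖ B'
  projective : letI := rightModule ι; Module.Projective Bᵐᵒᵖ B'

/-- The inclusion `j : A → B` identifies the C*-algebra `A` with an essential ideal of `B`:
the image is a two-sided ideal (closed, because injective *-homomorphisms of C*-algebras are
isometric) whose annihilator in `B` is zero. -/
structure IsEssentialIdealInclusion {A B : Type u} [NonUnitalCStarAlgebra A] [CStarAlgebra B]
    (j : A →⋆ₙₐ[ℂ] B) : Prop where
  injective : Function.Injective j
  mul_mem_left : ∀ (b : B) (a : A), b * j a ∈ Set.range j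
  mul_mem_right : ∀ (b : B) (a : A), j a * b ∈ Set.range j
  essential : ∀ b : B, (∀ a : A, b * j a = 0) → b = 0

/-- The triple `(A, A', G)`, with the inclusion `φ : A → A'`, is a noncommutative finite-fold
covering with compactification: there are unital C*-algebras `B`, `B'`, containing `A`, `A'` as
essential ideals, and a unital noncommutative finite-fold covering `(B, B', G)` whose inclusion
`ι : B → B'` extends `φ`, such that `A = B ∩ A'` inside `B'` and `G A' = A'`.
(An essential extension of `A` embeds in its multiplier algebra, so `B`, `B'` can be taken in the
universes of `A`, `A'`.) -/
def IsNCFiniteFoldCoveringWithCompactification {A : Type u} {A' : Type v}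
    [NonUnitalCStarAlgebra A] [NonUnitalCStarAlgebra A'] (φ : A →⋆ₙₐ[ℂ] A')
    (G : Type v) [Group G] : Prop :=
  Function.Injective φ ∧
    ∃ (B : Type u) (_ : CStarAlgebra B) (B' : Type v) (_ : CStarAlgebra B')
      (j : A →⋆ₙₐ[ℂ] B) (j' : A' →⋆ₙₐ[ℂ] B') (ι : B →⋆ₐ[ℂ] B') (ρ : G →* (B' ≃⋆ₐ[ℂ] B')),
      (∀ a, ι (j a) = j' (φ a)) ∧
      IsEssentialIdealInclusion j ∧
      IsEssentialIdealInclusion j' ∧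
      Set.range (fun a => ι (j a)) = Set.range ι ∩ Set.range j' ∧
      IsUnitalNCFiniteFoldCovering ι ρ ∧
      ∀ g : G, ρ g '' Set.range j' = Set.range j'

/-! From topology to algebra, take `B = C_b(X)`, `B' = C_b(X')` and the given finite group `H`. The
compactification serves for finite projectivity only. On the compact space `Y'`, a partition of
unity subordinate to open sets where the covering is injective yields functions `a k`, `b k` such
that `∑ k, a k p * b k q` is 1 for `p = q` and 0 for distinct points of one fibre. Restricted to
`X'` they give the reproducing formula `N * f = ∑ k, a k * E (b k * f)`, where `E` sums over `H` and
`N` counts stabilizers; this is a finite dual basis (`exists_dual_basis`).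

From algebra to topology, an essential extension of a commutative algebra is commutative, so Gelfand
duality applies and the character spaces of `B`, `B'` are compactifications of `X`, `X'`. Characters
of `B'` that agree on `B` form one `G`-orbit. A closed surjection whose fibres are finite orbits is
open, so it is a covering as soon as it is locally injective.

Local injectivity comes from finite generation. If `b = ∑ k, s k * ι (c k)`, then on a fibre the
oscillation of `b` is at most a constant times that of the `s k`. Were the `s k` to separate points
of one fibre arbitrarily near `x`, the functions `(s k - s k x) / √|s k - s k x|` would violate this
Lipschitz bound. So near `x` the generators, hence all functions, agree on points of one fibre. -/

open Topology Filter WeakDual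

/-! ## Topological preliminaries -/

/-- Urysohn's lemma for functions vanishing at infinity. -/
theorem exists_zeroAtInfty_eqOn_one_eqOn_zero {X : Type*} [TopologicalSpace X] [T2Space X]
    [LocallyCompactSpace X] {K C : Set X} (hK : IsCompact K) (hC : IsClosed C)
    (h : Disjoint K C) : ∃ f : C₀(X, ℂ), (∀ x ∈ K, f x = 1) ∧ ∀ x ∈ C, f x = 0 := by
  obtain ⟨g, h1, h0, hg, -⟩ := exists_continuous_one_zero_of_isCompact hK hC h
  have hs : HasCompactSupport fun x => (g x : ℂ) := hg.comp_left (g := ((↑) : ℝ → ℂ)) (by simp)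
  refine ⟨⟨⟨fun x => (g x : ℂ), by fun_prop⟩, hs.is_zero_at_infty⟩, fun x hx => ?_, fun x hx => ?_⟩
  · change ((g x : ℝ) : ℂ) = 1
    simp [h1 hx]
  · change ((g x : ℝ) : ℂ) = 0
    simp [h0 hx]

theorem exists_zeroAtInfty_apply_eq_one {X : Type*} [TopologicalSpace X] [T2Space X]
    [LocallyCompactSpace X] (x : X) : ∃ f : C₀(X, ℂ), f x = 1 := by
  obtain ⟨f, hf, -⟩ := exists_zeroAtInfty_eqOn_one_eqOn_zero (isCompact_singleton (x := x))
    isClosed_empty (Set.disjoint_empty _)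
  exact ⟨f, hf x rfl⟩

theorem exists_zeroAtInfty_ne {X : Type*} [TopologicalSpace X] [T2Space X]
    [LocallyCompactSpace X] {x y : X} (h : x ≠ y) : ∃ f : C₀(X, ℂ), f x = 1 ∧ f y = 0 := by
  obtain ⟨f, hf, hf'⟩ := exists_zeroAtInfty_eqOn_one_eqOn_zero (isCompact_singleton (x := x))
    (isClosed_singleton (x := y)) (by simpa using h)
  exact ⟨f, hf x rfl, hf' y rfl⟩

/-! ### Maps whose fibres are orbits of homeomorphisms -/

section FiniteOrbits

variable {E B : Type*} [TopologicalSpace E] {π : E → B} {ι : Type*} {T : ι → E ≃ₜ E}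

/-- Saturations are unions of translates, which makes open and closed maps interchangeable for
quotients by finitely many homeomorphisms. -/
theorem preimage_image_eq_iUnion_image (hT : ∀ x y, π x = π y ↔ ∃ i, T i x = y) (S : Set E) :
    π ⁻¹' (π '' S) = ⋃ i, T i '' S := by
  ext y
  simp only [Set.mem_preimage, Set.mem_image, Set.mem_iUnion, hT]
  exact ⟨fun ⟨x, hx, i, hi⟩ => ⟨i, x, hx, hi⟩, fun ⟨i, x, hx, hi⟩ => ⟨x, hx, i, hi⟩⟩

theorem finite_preimage_singleton_of_orbits [Finite ι] (hT : ∀ x y, π x = π y ↔ ∃ i, T i x = y)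
    (b : B) : (π ⁻¹' {b}).Finite := by
  rcases (π ⁻¹' {b}).eq_empty_or_nonempty with h | ⟨x, hx⟩
  · simp [h]
  · refine (Set.finite_range fun i => T i x).subset fun y hy => ?_
    exact (hT x y).1 (Eq.trans hx (Eq.symm hy))

variable [TopologicalSpace B]

theorem IsOpenMap.isClosedMap_of_orbits [Finite ι] (hT : ∀ x y, π x = π y ↔ ∃ i, T i x = y)
    (hc : Continuous π) (hs : Function.Surjective π) (ho : IsOpenMap π) : IsClosedMap π := by
  intro S hS
  rw [← (ho.isQuotientMap hc hs).isClosed_preimage, preimage_image_eq_iUnion_image hT]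
  exact isClosed_iUnion_of_finite fun i => (T i).isClosedMap S hS

theorem IsClosedMap.isOpenMap_of_orbits (hT : ∀ x y, π x = π y ↔ ∃ i, T i x = y)
    (hc : Continuous π) (hs : Function.Surjective π) (ho : IsClosedMap π) : IsOpenMap π := by
  intro S hS
  rw [← (ho.isQuotientMap hc hs).isOpen_preimage, preimage_image_eq_iUnion_image hT]
  exact isOpen_iUnion fun i => (T i).isOpenMap S hS

theorem IsOpenMap.isLocalHomeomorph_of_isLocallyInjective (hc : Continuous π) (ho : IsOpenMap π)
    (hi : IsLocallyInjective π) : IsLocalHomeomorph π := by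
  rw [isLocalHomeomorph_iff_isOpenEmbedding_restrict]
  intro x
  obtain ⟨U, hU, hx, hinj⟩ := hi x
  refine ⟨U, hU.mem_nhds hx, ?_⟩
  exact .of_continuous_injective_isOpenMap (hc.comp continuous_subtype_val)
    (Set.injOn_iff_injective.1 hinj) (ho.comp hU.isOpenMap_subtype_val)

/-- A closed locally injective surjection whose fibres are the orbits of finitely many
homeomorphisms is a covering map. -/
theorem IsClosedMap.isCoveringMap_of_orbits [T2Space E] [Finite ι]
    (hT : ∀ x y, π x = π y ↔ ∃ i, T i x = y) (hc : Continuous π) (hs : Function.Surjective π)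
    (hcl : IsClosedMap π) (hi : IsLocallyInjective π) : IsCoveringMap π := by
  have h := (hcl.isOpenMap_of_orbits hT hc hs).isLocalHomeomorph_of_isLocallyInjective hc hi
  rw [isCoveringMap_iff_isCoveringMapOn_univ]
  refine hcl.isCoveringMapOn_of_isLocalHomeomorphOn
    (fun b _ => finite_preimage_singleton_of_orbits hT b) ?_
  simpa [← isLocalHomeomorph_iff_isLocalHomeomorphOn_univ]

end FiniteOrbits

/-- On a compact Hausdorff space, the indicator function of the diagonal in the fibre product of
a locally injective map is a finite sum of products of continuous functions. -/
theorem IsLocallyInjective.exists_sum_mul_eq {E B : Type*} [TopologicalSpace E] [CompactSpace E]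
    [T2Space E] {π : E → B} (h : IsLocallyInjective π) :
    ∃ (n : ℕ) (a b : Fin n → C(E, ℂ)), (∀ p, ∑ k, a k p * b k p = 1) ∧
      ∀ p q, π p = π q → p ≠ q → ∀ k, a k p * b k q = 0 := by
  choose U hU hmem hinj using h
  obtain ⟨s, hs⟩ := isCompact_univ.elim_nhds_subcover U fun x _ => (hU x).mem_nhds (hmem x)
  let V : Fin s.card → Set E := fun k => U (s.equivFin.symm k)
  have hV : Set.univ ⊆ ⋃ k, V k := fun x hx => by
    obtain ⟨y, hy, hxy⟩ := Set.mem_iUnion₂.1 (hs.2 hx)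
    exact Set.mem_iUnion.2 ⟨s.equivFin ⟨y, hy⟩, by simpa [V] using hxy⟩
  obtain ⟨f, hf⟩ := PartitionOfUnity.exists_isSubordinate isClosed_univ V (fun k => hU _) hV
  -- The cutoff `g k` is 1 on the support of `f k`, so `∑ k, f k * g k = 1`; if `f k p * g k q ≠ 0`,
  -- both points lie in `V k`, where `π` is injective.
  have hμ : ∀ k, ∃ g : C(E, ℝ), Set.EqOn g 0 (V k)ᶜ ∧ Set.EqOn g 1 (tsupport (f k)) ∧
      ∀ x, g x ∈ Set.Icc (0 : ℝ) 1 := fun k =>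
    exists_continuous_zero_one_of_isClosed (hU _).isClosed_compl (isClosed_tsupport _)
      (Set.disjoint_compl_left_iff_subset.2 (hf k))
  choose g hg0 hg1 _ using hμ
  have hfg : ∀ k p, f k p * g k p = f k p := fun k p => by
    by_cases hp : f k p = 0
    · simp [hp]
    · simp [hg1 k (subset_tsupport _ hp)]
  refine ⟨s.card, fun k => ⟨fun x => (f k x : ℂ), by fun_prop⟩,
    fun k => ⟨fun x => (g k x : ℂ), by fun_prop⟩, fun p => ?_, fun p q hpq hne k => ?_⟩
  · have h1 := f.sum_eq_one (Set.mem_univ p)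
    rw [finsum_eq_sum_of_fintype] at h1
    simp only [ContinuousMap.coe_mk]
    exact_mod_cast (Finset.sum_congr rfl fun k _ => hfg k p).trans h1
  · simp only [ContinuousMap.coe_mk]
    by_cases hp : f k p = 0
    · simp [hp]
    · have hpV : p ∈ V k := hf k (subset_tsupport _ hp)
      have hqV : q ∈ (V k)ᶜ := fun hq => hne (hinj _ hpV hq hpq)
      simp [hg0 k hqV]

/-- Near zero, the map `z ↦ z / √|z|` expands distances by an arbitrarily large factor. -/
theorem norm_sub_le_mul_norm_div_sqrt_sub (z w : ℂ) :
    ‖z - w‖ ≤ (√‖z‖ + √‖w‖) * ‖z / (√‖z‖ : ℝ) - w / (√‖w‖ : ℝ)‖ := by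
  set F : ℂ → ℂ := fun z => z / (√‖z‖ : ℝ) with hF
  have key : ∀ z, (√‖z‖ : ℝ) * F z = z := fun z => by
    rcases eq_or_ne z 0 with rfl | hz
    · simp
    · have : ((√‖z‖ : ℝ) : ℂ) ≠ 0 := by
        exact_mod_cast (Real.sqrt_pos.2 (norm_pos_iff.2 hz)).ne'
      simp only [hF]
      field_simp
  have hn : ∀ z, ‖F z‖ = √‖z‖ := fun z => by
    simp only [hF, norm_div, Complex.norm_real, Real.norm_of_nonneg (Real.sqrt_nonneg _)]
    exact Real.div_sqrt
  -- The first term carries the difference of the `F`-values; the second is controlled by the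
  -- reverse triangle inequality, as `‖F z‖ = √‖z‖`.
  have e : z - w = (√‖z‖ : ℝ) * (F z - F w) + ((√‖z‖ - √‖w‖ : ℝ) : ℂ) * F w := by
    rw [mul_sub, key]
    push_cast
    rw [sub_mul, key]
    ring
  calc ‖z - w‖ ≤ √‖z‖ * ‖F z - F w‖ + |√‖z‖ - √‖w‖| * √‖w‖ := by
        conv_lhs => rw [e]
        refine (norm_add_le _ _).trans (le_of_eq ?_)
        rw [norm_mul, norm_mul, hn, Complex.norm_real, Complex.norm_real, Real.norm_eq_abs,
          Real.norm_eq_abs, abs_of_nonneg (Real.sqrt_nonneg _)]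
    _ ≤ √‖z‖ * ‖F z - F w‖ + ‖F z - F w‖ * √‖w‖ := by
        gcongr
        rw [← hn z, ← hn w]
        exact abs_norm_sub_norm_le _ _
    _ = (√‖z‖ + √‖w‖) * ‖F z - F w‖ := by ring

theorem continuous_div_sqrt_norm : Continuous fun z : ℂ => z / (√‖z‖ : ℝ) := by
  rw [continuous_iff_continuousAt]
  intro z
  rcases eq_or_ne z 0 with rfl | hz
  · have : Tendsto (fun z : ℂ => √‖z‖) (𝓝 0) (𝓝 0) := by
      have : Continuous fun z : ℂ => √‖z‖ := by fun_prop
      simpa using this.tendsto 0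
    rw [ContinuousAt, zero_div]
    refine squeeze_zero_norm (fun z => le_of_eq ?_) this
    rw [norm_div, Complex.norm_real, Real.norm_of_nonneg (Real.sqrt_nonneg _), Real.div_sqrt]
  · have : ((√‖z‖ : ℝ) : ℂ) ≠ 0 := by
      exact_mod_cast (Real.sqrt_pos.2 (norm_pos_iff.2 hz)).ne'
    exact ContinuousAt.div continuousAt_id (by fun_prop) this

/-- If along the fibres of `π` the oscillation of every continuous function is bounded by that of
finitely many given continuous functions, then `π` is locally injective. -/
theorem isLocallyInjective_of_norm_sub_le_sum {E B : Type*} [TopologicalSpace E] [CompactSpace E]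
    [T2Space E] {π : E → B} {n : ℕ} (a : Fin n → C(E, ℂ))
    (h : ∀ f : C(E, ℂ), ∃ C : ℝ, 0 ≤ C ∧
      ∀ p q, π p = π q → ‖f p - f q‖ ≤ C * ∑ k, ‖a k p - a k q‖) :
    IsLocallyInjective π := by
  intro x
  -- Test functions steeper at `x` than any Lipschitz function of the `a k`.
  let f : Fin n → C(E, ℂ) := fun k =>
    ⟨fun p => (a k p - a k x) / (√‖a k p - a k x‖ : ℝ),
      continuous_div_sqrt_norm.comp ((a k).continuous.sub continuous_const)⟩
  choose C hC0 hC using fun k => h (f k)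
  let r : E → ℝ := fun p => ∑ k, √‖a k p - a k x‖ * C k
  have hr : Continuous r := by fun_prop
  have hrx : r x = 0 := by simp [r]
  -- With the bound 1/2 at both points, `D ≤ (r p + r q) * D` has a factor below 1 and forces `D =
  -- 0`.
  refine ⟨{p | r p < 1 / 2}, isOpen_lt hr continuous_const, by simp [hrx], ?_⟩
  intro p hp q hq hpq
  set D := ∑ k, ‖a k p - a k q‖ with hD
  have hD0 : 0 ≤ D := Finset.sum_nonneg fun k _ => norm_nonneg _
  have hle : D ≤ (r p + r q) * D := by
    simp only [r]
    rw [← Finset.sum_add_distrib, Finset.sum_mul]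
    nth_rw 1 [hD]
    refine Finset.sum_le_sum fun k _ => ?_
    have h1 := norm_sub_le_mul_norm_div_sqrt_sub (a k p - a k x) (a k q - a k x)
    rw [sub_sub_sub_cancel_right] at h1
    refine h1.trans ?_
    rw [← add_mul, mul_assoc]
    gcongr
    exact hC k p q hpq
  have hD' : D = 0 := by
    simp only [Set.mem_ofPred_eq] at hp hq
    nlinarith
  -- Since `D = 0`, the hypothesis shows that no continuous function separates `p` from `q`.
  by_contra hne
  obtain ⟨g, hg0, hg1, -⟩ := exists_continuous_zero_one_of_isClosed (isClosed_singleton (x := p))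
    (isClosed_singleton (x := q)) (by simpa using hne)
  obtain ⟨K, -, hK⟩ := h ⟨fun x => (g x : ℂ), by fun_prop⟩
  have := hK p q hpq
  rw [← hD, hD'] at this
  simp [hg0 rfl, hg1 rfl] at this
  norm_num at this

/-! ## From coverings to C*-algebras -/

/-! ### Bounded functions and functions vanishing at infinity -/

section Pullback

open BoundedContinuousFunction

variable {X : Type u} {X' : Type v} [TopologicalSpace X] [TopologicalSpace X']

/-- Composition with a continuous map, as a homomorphism of algebras of bounded functions. -/
noncomputable def ContinuousMap.pullbackBCF (π : C(X', X)) : (X →ᵇ ℂ) →⋆ₐ[ℂ] (X' →ᵇ ℂ) where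
  toFun f := f.compContinuous π
  map_one' := rfl
  map_mul' _ _ := rfl
  map_zero' := rfl
  map_add' _ _ := rfl
  commutes' _ := rfl
  map_star' _ := rfl

@[simp]
theorem ContinuousMap.pullbackBCF_apply (π : C(X', X)) (f : X →ᵇ ℂ) (x : X') :
    π.pullbackBCF f x = f (π x) := rfl

/-- The action of the self-homeomorphisms of a space on its bounded continuous functions. -/
noncomputable def homeomorphActionBCF : (X' ≃ₜ X') →* ((X' →ᵇ ℂ) ≃⋆ₐ[ℂ] (X' →ᵇ ℂ)) where
  toFun h :=
    { toFun f := f.compContinuous (h.symm : C(X', X'))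
      invFun f := f.compContinuous (h : C(X', X'))
      left_inv f := by ext x; simp
      right_inv f := by ext x; simp
      map_mul' _ _ := rfl
      map_add' _ _ := rfl
      map_star' _ := rfl
      map_smul' _ _ := rfl }
  map_one' := rfl
  map_mul' _ _ := rfl

/-- The inclusion of the functions vanishing at infinity in the bounded functions. -/
noncomputable def zeroAtInftyToBCF (X : Type u) [TopologicalSpace X] : C₀(X, ℂ) →⋆ₙₐ[ℂ] (X →ᵇ ℂ) where
  toFun f := f.toBCF
  map_smul' _ _ := rfl
  map_zero' := rfl
  map_add' _ _ := rfl
  map_mul' _ _ := rfl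
  map_star' _ := rfl

@[simp]
theorem zeroAtInftyToBCF_apply (f : C₀(X, ℂ)) (x : X) : zeroAtInftyToBCF X f x = f x := rfl

theorem mem_range_zeroAtInftyToBCF {f : X →ᵇ ℂ} :
    f ∈ Set.range (zeroAtInftyToBCF X) ↔ Tendsto f (cocompact X) (𝓝 0) := by
  constructor
  · rintro ⟨g, rfl⟩
    exact g.zero_at_infty'
  · intro h
    exact ⟨⟨f.toContinuousMap, h⟩, rfl⟩

theorem isEssentialIdealInclusion_zeroAtInftyToBCF [T2Space X] [LocallyCompactSpace X] :
    IsEssentialIdealInclusion (zeroAtInftyToBCF X) where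
  injective _ _ h := ZeroAtInftyContinuousMap.toBCF_injective X ℂ h
  mul_mem_left b a := by
    rw [mem_range_zeroAtInftyToBCF]
    refine squeeze_zero_norm (a := fun x => ‖b‖ * ‖a x‖) (fun x => ?_) ?_
    · simpa using mul_le_mul_of_nonneg_right (b.norm_coe_le_norm x) (norm_nonneg (a x))
    · simpa using (a.zero_at_infty'.norm).const_mul ‖b‖
  mul_mem_right b a := by
    rw [mem_range_zeroAtInftyToBCF]
    refine squeeze_zero_norm (a := fun x => ‖a x‖ * ‖b‖) (fun x => ?_) ?_
    · simpa using mul_le_mul_of_nonneg_left (b.norm_coe_le_norm x) (norm_nonneg (a x))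
    · simpa using (a.zero_at_infty'.norm).mul_const ‖b‖
  essential b h := by
    ext x
    obtain ⟨f, hf⟩ := exists_zeroAtInfty_apply_eq_one x
    simpa [hf] using DFunLike.congr_fun (h f) x

theorem IsProperMap.tendsto_cocompact {π : X' → X} (hπ : IsProperMap π) :
    Tendsto π (cocompact X') (cocompact X) :=
  hasBasis_cocompact.tendsto_right_iff.2 fun _ hK => (hπ.isCompact_preimage hK).compl_mem_cocompact

/-- Composition with a proper map, on functions vanishing at infinity. -/
noncomputable def IsProperMap.pullbackZeroAtInfty {π : X' → X} (hπ : IsProperMap π) :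
    C₀(X, ℂ) →⋆ₙₐ[ℂ] C₀(X', ℂ) where
  toFun f := ⟨⟨fun x => f (π x), f.continuous.comp hπ.continuous⟩,
    f.zero_at_infty'.comp hπ.tendsto_cocompact⟩
  map_smul' _ _ := rfl
  map_zero' := rfl
  map_add' _ _ := rfl
  map_mul' _ _ := rfl
  map_star' _ := rfl

/-- A bounded function is zero at infinity if its pullback along a continuous surjection is. -/
theorem tendsto_cocompact_of_comp {π : X' → X} (hc : Continuous π) (hs : Function.Surjective π)
    {f : X → ℂ} (h : Tendsto (fun x => f (π x)) (cocompact X') (𝓝 0)) :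
    Tendsto f (cocompact X) (𝓝 0) := by
  rw [Metric.tendsto_nhds] at h ⊢
  intro ε hε
  obtain ⟨K, hK, hKs⟩ := mem_cocompact.1 (h ε hε)
  refine mem_cocompact.2 ⟨π '' K, hK.image hc, fun x hx => ?_⟩
  obtain ⟨y, rfl⟩ := hs x
  exact hKs fun hy => hx ⟨y, hy, rfl⟩

end Pullback

/-- A right module with a finite dual basis is finitely generated and projective. -/
theorem rightModule_finite_and_projective {B : Type u} {B' : Type v} [CStarAlgebra B]
    [CStarAlgebra B'] (ι : B →⋆ₐ[ℂ] B') {n : ℕ} (α : Fin n → B') (E : Fin n → B' → B)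
    (hadd : ∀ k x y, E k (x + y) = E k x + E k y) (hmul : ∀ k x b, E k (x * ι b) = E k x * b)
    (hE : ∀ x, ∑ k, α k * ι (E k x) = x) :
    letI := rightModule ι; Module.Finite Bᵐᵒᵖ B' ∧ Module.Projective Bᵐᵒᵖ B' := by
  let := rightModule ι
  have smul_def : ∀ (b : Bᵐᵒᵖ) (x : B'), b • x = x * ι b.unop := fun b x => rfl
  let s : B' →ₗ[Bᵐᵒᵖ] (Fin n → Bᵐᵒᵖ) :=
    { toFun x k := MulOpposite.op (E k x)
      map_add' x y := by ext k; simp [hadd]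
      map_smul' b x := by
        ext k
        simp [smul_def, hmul] }
  let t : (Fin n → Bᵐᵒᵖ) →ₗ[Bᵐᵒᵖ] B' :=
    { toFun c := ∑ k, α k * ι (c k).unop
      map_add' x y := by simp [mul_add, Finset.sum_add_distrib]
      map_smul' b x := by simp [smul_def, Finset.sum_mul, mul_assoc] }
  have hts : t ∘ₗ s = LinearMap.id := LinearMap.ext hE
  exact ⟨Module.Finite.of_surjective t fun x => ⟨s x, LinearMap.congr_fun hts x⟩,
    Module.Projective.of_split s t hts⟩

/-! ### The noncommutative covering attached to a regular covering -/

section Covering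

open BoundedContinuousFunction

variable {X : Type u} {X' : Type v} [TopologicalSpace X] [TopologicalSpace X'] {π : X' → X}

/-- A continuous function which is constant on the fibres of a quotient map descends. -/
theorem exists_bcf_of_fiberwise_constant (hq : IsQuotientMap π) (f : X' →ᵇ ℂ)
    (hf : ∀ x y, π x = π y → f x = f y) : ∃ g : X →ᵇ ℂ, ∀ x, g (π x) = f x := by
  let g : X → ℂ := Function.extend π f 0
  have hg : ∀ x, g (π x) = f x :=
    fun x => Function.FactorsThrough.extend_apply (fun a b h => hf a b h) 0 x
  refine ⟨BoundedContinuousFunction.ofNormedAddCommGroup g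
    (hq.continuous_iff.2 (by simpa [Function.comp_def, hg] using f.continuous)) ‖f‖ fun x => ?_, hg⟩
  obtain ⟨y, rfl⟩ := hq.surjective x
  rw [hg]
  exact f.norm_coe_le_norm y

/-- The transfer of bounded functions along a quotient map by a finite group. -/
theorem exists_transfer (hq : IsQuotientMap π) {H : Subgroup (X' ≃ₜ X')} [Fintype H]
    (hH : ∀ x y, π x = π y ↔ ∃ h : H, (h : X' ≃ₜ X') x = y) :
    ∃ E : (X' →ᵇ ℂ) → (X →ᵇ ℂ), ∀ f x, E f (π x) = ∑ h : H, f ((h : X' ≃ₜ X') x) := by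
  have : ∀ f : X' →ᵇ ℂ, ∃ g : X →ᵇ ℂ, ∀ x, g (π x) = ∑ h : H, f ((h : X' ≃ₜ X') x) := by
    intro f
    obtain ⟨g, hg⟩ := exists_bcf_of_fiberwise_constant hq
      (∑ h : H, f.compContinuous ((h : X' ≃ₜ X') : C(X', X'))) (fun x y hxy => by
        obtain ⟨k, rfl⟩ := (hH x y).1 hxy
        simp only [BoundedContinuousFunction.coe_sum, Finset.sum_apply,
          BoundedContinuousFunction.compContinuous_apply]
        exact (Fintype.sum_equiv (Equiv.mulRight k) _ _ fun h => rfl).symm)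
    exact ⟨g, fun x => by simp [hg]⟩
  choose E hE using this
  exact ⟨E, hE⟩

/-- A bounded function on a compactification restricts to a bounded function. -/
noncomputable def ContinuousMap.restrictBCF {Y : Type*} [TopologicalSpace Y] [CompactSpace Y] (f : C(Y, ℂ))
    (e : C(X, Y)) : X →ᵇ ℂ :=
  (BoundedContinuousFunction.mkOfCompact f).compContinuous e

theorem exists_dual_basis (hq : IsQuotientMap π) {H : Subgroup (X' ≃ₜ X')} [Finite H]
    (hH : ∀ x y, π x = π y ↔ ∃ h : H, (h : X' ≃ₜ X') x = y)
    {n : ℕ} (a b : Fin n → (X' →ᵇ ℂ)) (h1 : ∀ p, ∑ k, a k p * b k p = 1)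
    (h0 : ∀ p q, π p = π q → p ≠ q → ∀ k, a k p * b k q = 0) :
    letI ι := ContinuousMap.pullbackBCF ⟨π, hq.continuous⟩
    letI := rightModule ι
    Module.Finite (X →ᵇ ℂ)ᵐᵒᵖ (X' →ᵇ ℂ) ∧ Module.Projective (X →ᵇ ℂ)ᵐᵒᵖ (X' →ᵇ ℂ) := by
  classical
  have := Fintype.ofFinite H
  obtain ⟨E, hE⟩ := exists_transfer hq hH
  -- The action need not be free: `N p` is the order of the stabilizer of `p`, by which the
  -- reproducing formula must be divided.
  let N : X' → ℕ := fun p => (Finset.univ.filter fun h : H => (h : X' ≃ₜ X') p = p).card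
  have hN : ∀ p, 1 ≤ N p := fun p =>
    Finset.card_pos.2 ⟨1, by simp⟩
  have key : ∀ (f : X' →ᵇ ℂ) p, ∑ k, a k p * E (b k * f) (π p) = N p * f p := by
    intro f p
    simp only [hE, Finset.mul_sum]
    rw [Finset.sum_comm]
    have : ∀ h : H, ∑ k, a k p * (b k * f) ((h : X' ≃ₜ X') p) =
        if (h : X' ≃ₜ X') p = p then f p else 0 := by
      intro h
      split_ifs with hp
      · simp [hp, ← mul_assoc, ← Finset.sum_mul, h1]
      · refine Finset.sum_eq_zero fun k _ => ?_
        rw [BoundedContinuousFunction.mul_apply, ← mul_assoc,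
          h0 p _ ((hH _ _).2 ⟨h, rfl⟩) (Ne.symm hp) k, zero_mul]
    rw [Finset.sum_congr rfl fun h _ => this h, ← Finset.sum_filter, Finset.sum_const,
      nsmul_eq_mul]
  -- The reproducing formula for `f = 1` exhibits `N` as a continuous function, so its inverse is an
  -- admissible coefficient.
  let s : X' →ᵇ ℂ := ∑ k, a k * (ContinuousMap.pullbackBCF ⟨π, hq.continuous⟩) (E (b k))
  have hs : ∀ p, s p = N p := fun p => by
    simpa [s] using key 1 p
  have hs0 : ∀ p, s p ≠ 0 := fun p => by
    rw [hs]
    exact_mod_cast (Nat.one_le_iff_ne_zero.1 (hN p))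
  let t : X' →ᵇ ℂ := BoundedContinuousFunction.ofNormedAddCommGroup (fun p => (s p)⁻¹)
    (s.continuous.inv₀ hs0) 1 fun p => by
      rw [norm_inv, hs, Complex.norm_natCast]
      exact inv_le_one_of_one_le₀ (by exact_mod_cast hN p)
  have ht : ∀ p, t p * N p = 1 := fun p => by
    rw [← hs]
    exact inv_mul_cancel₀ (hs0 p)
  have hsurj := hq.surjective
  refine rightModule_finite_and_projective _ (fun k => t * a k) (fun k f => E (b k * f)) ?_ ?_ ?_
  · intro k x y
    ext p
    obtain ⟨p, rfl⟩ := hsurj p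
    simp [hE, mul_add, Finset.sum_add_distrib]
  · intro k x c
    ext p
    obtain ⟨p, rfl⟩ := hsurj p
    simp only [hE, BoundedContinuousFunction.mul_apply, Finset.sum_mul,
      ContinuousMap.pullbackBCF_apply, ContinuousMap.coe_mk]
    refine Finset.sum_congr rfl fun h _ => ?_
    rw [(hH ((h : X' ≃ₜ X') p) p).2 ⟨h⁻¹, (h : X' ≃ₜ X').symm_apply_apply p⟩, mul_assoc]
  · intro f
    ext p
    simp only [BoundedContinuousFunction.coe_sum, Finset.sum_apply,
      BoundedContinuousFunction.mul_apply, ContinuousMap.pullbackBCF_apply, ContinuousMap.coe_mk,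
      mul_assoc, ← Finset.mul_sum]
    rw [key, ← mul_assoc, ht, one_mul]

/-- The group `H` need not act on the given `Y'`, but it acts on all bounded functions on `X'`;
hence the choice of `C_b` in place of `C(Y)` and `C(Y')`. -/
theorem exists_isNCFiniteFoldCovering_of_isRegular [T2Space X] [T2Space X'] [LocallyCompactSpace X]
    [LocallyCompactSpace X'] (hπ : Continuous π) (hsurj : Function.Surjective π)
    (h : IsRegularFiniteFoldCoveringWithCompactification π) :
    ∃ φ : C₀(X, ℂ) →⋆ₙₐ[ℂ] C₀(X', ℂ), (∀ f x, φ f x = f (π x)) ∧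
      ∃ (G : Type v) (_ : Group G), IsNCFiniteFoldCoveringWithCompactification φ G := by
  obtain ⟨⟨hcov, Y, _, Y', _, e, e', πbar, he, he', hbar, hcomm⟩, hfin, H, hHle, hHfin, hH⟩ := h
  have hH' : ∀ x y, π x = π y ↔ ∃ h : H, (h : X' ≃ₜ X') x = y := fun x y =>
    ⟨fun hxy => let ⟨h, hh, e⟩ := hH x y hxy; ⟨⟨h, hh⟩, e⟩,
      fun ⟨h, hh⟩ => hh ▸ (hHle h.2 x).symm⟩
  have hclosed : IsClosedMap π := hcov.isOpenMap.isClosedMap_of_orbits hH' hπ hsurj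
  have hproper : IsProperMap π := isProperMap_iff_isClosedMap_and_compact_fibers.2
    ⟨hπ, hclosed, fun x => (hfin x).isCompact⟩
  have hq : IsQuotientMap π := hcov.isQuotientMap hsurj
  have := he'.compactSpace
  have := he'.t2Space
  obtain ⟨n, a, b, h1, h0⟩ := hbar.isLocalHomeomorph.isLocallyInjective.exists_sum_mul_eq
  let ec : C(X', Y') := ⟨e', he'.isEmbedding.continuous⟩
  have hdual := exists_dual_basis hq hH' (fun k => (a k).restrictBCF ec)
    (fun k => (b k).restrictBCF ec) (fun p => h1 (e' p))
    (fun p q hpq hne => h0 (e' p) (e' q) (by rw [hcomm, hcomm, hpq])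
      (he'.isEmbedding.injective.ne hne))
  refine ⟨hproper.pullbackZeroAtInfty, fun _ _ => rfl, H, inferInstance, ?_, X →ᵇ ℂ, inferInstance,
    X' →ᵇ ℂ, inferInstance, zeroAtInftyToBCF X, zeroAtInftyToBCF X',
    ContinuousMap.pullbackBCF ⟨π, hπ⟩, homeomorphActionBCF.comp H.subtype, fun _ => rfl,
    isEssentialIdealInclusion_zeroAtInftyToBCF, isEssentialIdealInclusion_zeroAtInftyToBCF,
    ?_, ⟨?_, hHfin, ?_, ?_, hdual.1, hdual.2⟩, ?_⟩
  · intro f g hfg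
    ext x
    obtain ⟨y, rfl⟩ := hsurj x
    exact DFunLike.congr_fun hfg y
  · ext f
    constructor
    · rintro ⟨g, rfl⟩
      exact ⟨⟨_, rfl⟩, hproper.pullbackZeroAtInfty g, rfl⟩
    · rintro ⟨⟨g, rfl⟩, hg⟩
      obtain ⟨g, rfl⟩ := mem_range_zeroAtInftyToBCF.2 (tendsto_cocompact_of_comp hπ hsurj
        (mem_range_zeroAtInftyToBCF.1 hg))
      exact ⟨g, rfl⟩
  · intro f g hfg
    ext x
    obtain ⟨y, rfl⟩ := hsurj x
    exact DFunLike.congr_fun hfg y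
  · intro h hne
    have : ∃ x, (h : X' ≃ₜ X')⁻¹ x ≠ x := by
      by_contra! hall
      refine hne (inv_eq_one.1 (Subtype.ext (Homeomorph.ext hall)))
    obtain ⟨x, hx⟩ := this
    obtain ⟨f, hf, hf'⟩ := exists_zeroAtInfty_ne hx
    refine ⟨zeroAtInftyToBCF X' f, fun heq => ?_⟩
    have h1 : f ((h : X' ≃ₜ X')⁻¹ x) = f x := DFunLike.congr_fun heq x
    rw [hf, hf'] at h1
    exact one_ne_zero h1
  · intro f
    constructor
    · rintro ⟨g, rfl⟩ h
      ext x
      exact congrArg g ((hHle (inv_mem h.2)) x)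
    · intro hf
      obtain ⟨g, hg⟩ := exists_bcf_of_fiberwise_constant hq f fun x y hxy => by
        obtain ⟨h, rfl⟩ := (hH' x y).1 hxy
        have h1 : f ((h : X' ≃ₜ X') x) = f x := DFunLike.congr_fun (hf h⁻¹) x
        exact h1.symm
      exact ⟨g, by ext x; exact hg x⟩
  · have hle : ∀ g : H, homeomorphActionBCF (g : X' ≃ₜ X') '' Set.range (zeroAtInftyToBCF X') ⊆
        Set.range (zeroAtInftyToBCF X') := by
      rintro g _ ⟨_, ⟨f, rfl⟩, rfl⟩
      exact mem_range_zeroAtInftyToBCF.2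
        (f.zero_at_infty'.comp (g : X' ≃ₜ X').symm.isProperMap.tendsto_cocompact)
    refine fun g => (hle g).antisymm fun f hf => ?_
    refine ⟨homeomorphActionBCF ((g⁻¹ : H) : X' ≃ₜ X') f, hle _ ⟨f, hf, rfl⟩, ?_⟩
    ext x
    exact congrArg f ((g : X' ≃ₜ X').apply_symm_apply x)

end Covering

/-! ## From C*-algebras to coverings -/

/-- Multiplied by two elements of the ideal, `b * c - c * b` vanishes, as `b` and `c` can be
absorbed into the commutative ideal. The C*-identity removes one factor, essentiality the other. -/
theorem IsEssentialIdealInclusion.mul_comm {A B : Type u} [NonUnitalCStarAlgebra A]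
    [CStarAlgebra B] {j : A →⋆ₙₐ[ℂ] B} (hj : IsEssentialIdealInclusion j)
    (hA : ∀ a b : A, a * b = b * a) (b c : B) : b * c = c * b := by
  have comm : ∀ a a', j a * j a' = j a' * j a := fun a a' => by rw [← map_mul, hA, map_mul]
  have key : ∀ a a' : A, b * c * j a * j a' = c * b * j a * j a' := by
    intro a a'
    obtain ⟨d, hd⟩ := hj.mul_mem_left c a
    obtain ⟨d', hd'⟩ := hj.mul_mem_left b a'
    calc b * c * j a * j a' = b * (j d * j a') := by rw [hd]; simp only [mul_assoc]
      _ = j d' * j d := by rw [comm, hd', mul_assoc]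
      _ = c * (j a * j d') := by rw [comm, hd, mul_assoc]
      _ = c * b * j a * j a' := by rw [comm, hd', mul_assoc, mul_assoc, mul_assoc, comm]
  rw [← sub_eq_zero]
  refine hj.essential _ fun a => ?_
  obtain ⟨d, hd⟩ := hj.mul_mem_left (b * c - c * b) a
  have h0 : d * star d = 0 := hj.injective <| by
    rw [map_mul, hd, map_zero, sub_mul, sub_mul, key, sub_self]
  rw [← hd, (CStarRing.mul_star_self_eq_zero_iff d).1 h0, map_zero]

/-! ### Character spaces as compactifications -/

section Boundary

variable {X B : Type u} [TopologicalSpace X] [T2Space X] [LocallyCompactSpace X]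
  [CommCStarAlgebra B] {j : C₀(X, ℂ) →⋆ₙₐ[ℂ] B}

/-- Evaluation at a point extends from an essential ideal to a character of the algebra. -/
theorem IsEssentialIdealInclusion.exists_character (hj : IsEssentialIdealInclusion j) (x : X) :
    ∃ χ : characterSpace ℂ B, ∀ (b : B) (a c : C₀(X, ℂ)), j c = b * j a → χ b * a x = c x := by
  obtain ⟨a₀, ha₀⟩ := exists_zeroAtInfty_apply_eq_one x
  choose L hL using fun b => hj.mul_mem_left b a₀
  -- The value of `b` at `x` is that of `b * j a₀`; this relation makes it independent of `a₀` and
  -- yields multiplicativity.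
  have key : ∀ (b : B) (a c : C₀(X, ℂ)), j c = b * j a → L b x * a x = c x := by
    intro b a c h
    have : L b * a = c * a₀ := hj.injective <| by
      rw [map_mul, map_mul, hL, h, mul_assoc, mul_assoc, _root_.mul_comm (j a)]
    simpa [ha₀] using DFunLike.congr_fun this x
  have key' : ∀ (b : B) (c : C₀(X, ℂ)), j c = b * j a₀ → L b x = c x := fun b c h => by
    simpa [ha₀] using key b a₀ c h
  let χ : B →ₐ[ℂ] ℂ :=
    { toFun b := L b x
      map_one' := by rw [key' 1 a₀ (one_mul _).symm, ha₀]
      map_mul' b c := by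
        simpa [ha₀] using key (b * c) (a₀ * a₀) (L b * L c) (by
          rw [map_mul, map_mul, hL, hL]
          ring)
      map_zero' := key' 0 0 (by simp)
      map_add' b c := key' _ (L b + L c) (by simp [hL, add_mul])
      commutes' r := by
        rw [key' _ (r • a₀) (by rw [map_smul, Algebra.smul_def])]
        simp [ha₀] }
  exact ⟨CharacterSpace.equivAlgHom.symm χ, key⟩

/-- The map from `X` to the characters of an algebra containing `C₀(X)` as an essential ideal. -/
noncomputable def IsEssentialIdealInclusion.boundaryMap (hj : IsEssentialIdealInclusion j) (x : X) :
    characterSpace ℂ B :=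
  (hj.exists_character x).choose

namespace IsEssentialIdealInclusion

variable (hj : IsEssentialIdealInclusion j)

theorem boundaryMap_mul (x : X) {b : B} {a c : C₀(X, ℂ)} (h : j c = b * j a) :
    hj.boundaryMap x b * a x = c x :=
  (hj.exists_character x).choose_spec b a c h

theorem boundaryMap_apply (x : X) (a : C₀(X, ℂ)) : hj.boundaryMap x (j a) = a x := by
  obtain ⟨a₀, ha₀⟩ := exists_zeroAtInfty_apply_eq_one x
  simpa [ha₀] using hj.boundaryMap_mul x (map_mul j a a₀)

theorem continuous_boundaryMap : Continuous hj.boundaryMap := by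
  refine Continuous.subtype_mk (WeakDual.continuous_of_continuous_eval fun b => ?_) _
  change Continuous fun x => hj.boundaryMap x b
  rw [continuous_iff_continuousAt]
  intro x
  obtain ⟨a, ha⟩ := exists_zeroAtInfty_apply_eq_one x
  obtain ⟨c, hc⟩ := hj.mul_mem_left b a
  have ha0 : a x ≠ 0 := by simp [ha]
  have : ContinuousAt (fun y => c y / a y) x :=
    c.continuous.continuousAt.div a.continuous.continuousAt ha0
  refine this.congr ?_
  filter_upwards [a.continuous.continuousAt.eventually_ne ha0] with y hy
  rw [← hj.boundaryMap_mul y hc]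
  exact mul_div_cancel_right₀ _ hy

theorem continuous_character_apply (b : B) : Continuous fun χ : characterSpace ℂ B => χ b :=
  (gelfandStarTransform B b).continuous

theorem isEmbedding_boundaryMap : IsEmbedding hj.boundaryMap := by
  refine IsInducing.isEmbedding (isInducing_iff_nhds.2 fun x => le_antisymm
    hj.continuous_boundaryMap.continuousAt.le_comap fun U hU => ?_)
  obtain ⟨V, hVU, hV, hx⟩ := mem_nhds_iff.1 hU
  obtain ⟨f, hf1, hf0⟩ := exists_zeroAtInfty_eqOn_one_eqOn_zero (isCompact_singleton (x := x))
    hV.isClosed_compl (by simpa using hx)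
  refine ⟨{χ | χ (j f) ≠ 0}, ?_, fun y hy => hVU ?_⟩
  · refine (isOpen_ne_fun (continuous_character_apply _) continuous_const).mem_nhds ?_
    change hj.boundaryMap x (j f) ≠ 0
    simp [hj.boundaryMap_apply, hf1]
  · by_contra hyV
    refine hy ?_
    rw [hj.boundaryMap_apply, hf0 y hyV]

/-- A character off the closure of `X` would be detected by an element of `B` vanishing on `X`; such
an element annihilates the ideal, so it is zero by essentiality. -/
theorem denseRange_boundaryMap : DenseRange hj.boundaryMap := by
  intro χ
  by_contra hχ
  obtain ⟨g, hg0, hg1, -⟩ := exists_continuous_zero_one_of_isClosed isClosed_closure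
    (isClosed_singleton (x := χ)) (by simpa using hχ)
  obtain ⟨b, hb⟩ := (gelfandStarTransform B).surjective ⟨fun x => (g x : ℂ), by fun_prop⟩
  have hb' : ∀ ψ : characterSpace ℂ B, ψ b = g ψ := fun ψ => DFunLike.congr_fun hb ψ
  have : b = 0 := hj.essential b fun a => by
    obtain ⟨c, hc⟩ := hj.mul_mem_left b a
    have hc0 : c = 0 := by
      ext x
      rw [← hj.boundaryMap_mul x hc, hb', hg0 (subset_closure ⟨x, rfl⟩)]
      simp
    rw [← hc, hc0, map_zero]
  have h1 := hb' χ
  rw [this, map_zero, hg1 rfl] at h1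
  simp at h1

theorem isCompactification_boundaryMap : IsCompactification hj.boundaryMap :=
  ⟨inferInstance, inferInstance, hj.isEmbedding_boundaryMap, hj.denseRange_boundaryMap⟩

/-- A character outside the range of the boundary map vanishes on the ideal. -/
theorem apply_eq_zero_of_notMem_range {χ : characterSpace ℂ B}
    (hχ : χ ∉ Set.range hj.boundaryMap) (f : C₀(X, ℂ)) : χ (j f) = 0 := by
  rw [← norm_eq_zero]
  refine le_antisymm (le_of_forall_pos_le_add fun ε hε => ?_) (norm_nonneg _)
  rw [zero_add]
  obtain ⟨K, hK, hKs⟩ := mem_cocompact.1 ((Metric.tendsto_nhds.1 f.zero_at_infty') ε hε)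
  have hKc : IsClosed (hj.boundaryMap '' K) := (hK.image hj.continuous_boundaryMap).isClosed
  have hχK : χ ∈ (hj.boundaryMap '' K)ᶜ := fun ⟨x, _, hx⟩ => hχ ⟨x, hx⟩
  -- By density, `χ` is a limit of points of `X` outside `K`, where `‖f‖ < ε`.
  have hmem : χ ∈ closure ((hj.boundaryMap '' K)ᶜ ∩ Set.range hj.boundaryMap) :=
    hj.denseRange_boundaryMap.open_subset_closure_inter hKc.isOpen_compl hχK
  refine closure_minimal ?_ (isClosed_le (continuous_character_apply (j f)).norm
    (continuous_const (y := ε))) hmem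
  rintro _ ⟨hx, x, rfl⟩
  have : dist (f x) 0 < ε := hKs fun hxK => hx ⟨x, hxK, rfl⟩
  change ‖hj.boundaryMap x (j f)‖ ≤ ε
  rw [hj.boundaryMap_apply]
  simpa using this.le

end IsEssentialIdealInclusion

end Boundary

/-! ### The map of character spaces of a unital covering -/

section UnitalCovering

variable {B : Type u} {B' : Type v} [CommCStarAlgebra B] [CommCStarAlgebra B']

/-- A *-automorphism acts on the characters by precomposition. -/
noncomputable def characterSpaceHomeomorph (α : B' ≃⋆ₐ[ℂ] B') :
    characterSpace ℂ B' ≃ₜ characterSpace ℂ B' where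
  toFun := CharacterSpace.compContinuousMap (α : B' →⋆ₐ[ℂ] B')
  invFun := CharacterSpace.compContinuousMap (α.symm : B' →⋆ₐ[ℂ] B')
  left_inv χ := CharacterSpace.ext fun b => congrArg χ (α.apply_symm_apply b)
  right_inv χ := CharacterSpace.ext fun b => congrArg χ (α.symm_apply_apply b)
  continuous_toFun := ContinuousMap.continuous _
  continuous_invFun := ContinuousMap.continuous _

theorem characterSpaceHomeomorph_apply (α : B' ≃⋆ₐ[ℂ] B') (χ : characterSpace ℂ B') (b : B') :
    characterSpaceHomeomorph α χ b = χ (α b) := rfl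

variable {ι : B →⋆ₐ[ℂ] B'} {G : Type v} [Group G] {ρ : G →* (B' ≃⋆ₐ[ℂ] B')}

/-- The characters that agree on the fixed-point algebra of a finite group form one orbit. -/
theorem IsUnitalNCFiniteFoldCovering.compContinuousMap_eq_iff
    (h : IsUnitalNCFiniteFoldCovering ι ρ) (χ ψ : characterSpace ℂ B') :
    CharacterSpace.compContinuousMap ι χ = CharacterSpace.compContinuousMap ι ψ ↔
      ∃ g, characterSpaceHomeomorph (ρ g) χ = ψ := by
  have := h.finite
  have := Fintype.ofFinite G
  constructor
  · intro heq
    by_contra! hne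
    obtain ⟨f, hf0, hf1, -⟩ := exists_continuous_zero_one_of_isClosed (isClosed_singleton (x := ψ))
      (Set.finite_range fun g => characterSpaceHomeomorph (ρ g) χ).isClosed
      (by simpa using hne)
    obtain ⟨b, hb⟩ := (gelfandStarTransform B').surjective ⟨fun x => (f x : ℂ), by fun_prop⟩
    have hb' : ∀ ψ : characterSpace ℂ B', ψ b = f ψ := fun ψ => DFunLike.congr_fun hb ψ
    -- The product over the group lies in the fixed-point algebra, yet is 0 at `ψ` and 1 at `χ`.
    obtain ⟨c, hc⟩ := (h.mem_range_iff_fixed (∏ g, ρ g b)).2 fun g => by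
      rw [map_prod]
      exact Fintype.prod_equiv (Equiv.mulLeft g) _ _ fun k => by
        rw [Equiv.coe_mulLeft, map_mul]
        rfl
    have h1 : χ (ι c) = ψ (ι c) := DFunLike.congr_fun heq c
    rw [hc, map_prod, map_prod] at h1
    have h2 : ∏ g, ψ (ρ g b) = 0 := Finset.prod_eq_zero (Finset.mem_univ 1) <| by
      rw [map_one]
      exact (hb' ψ).trans (by simp [hf0 rfl])
    have h3 : ∏ g, χ (ρ g b) = 1 := Finset.prod_eq_one fun g _ => by
      rw [← characterSpaceHomeomorph_apply, hb', hf1 ⟨g, rfl⟩]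
      simp
    rw [h2, h3] at h1
    exact one_ne_zero h1
  · rintro ⟨g, rfl⟩
    exact CharacterSpace.ext fun b =>
      congrArg χ ((h.mem_range_iff_fixed _).1 ⟨b, rfl⟩ g).symm

/-- Finite generation makes the map of character spaces locally injective. -/
theorem IsUnitalNCFiniteFoldCovering.isLocallyInjective (h : IsUnitalNCFiniteFoldCovering ι ρ) :
    IsLocallyInjective (CharacterSpace.compContinuousMap ι) := by
  let := rightModule ι
  have := h.finitelyGenerated
  obtain ⟨n, s, hs⟩ := Module.Finite.exists_fin (R := Bᵐᵒᵖ) (M := B')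
  refine isLocallyInjective_of_norm_sub_le_sum (fun k => gelfandStarTransform B' (s k)) fun f => ?_
  obtain ⟨b, rfl⟩ := (gelfandStarTransform B').surjective f
  obtain ⟨c, hc⟩ := (Submodule.mem_span_range_iff_exists_fun Bᵐᵒᵖ).1
    (hs ▸ Submodule.mem_top : b ∈ Submodule.span Bᵐᵒᵖ (Set.range s))
  have hc' : ∑ k, s k * ι (c k).unop = b := hc
  let K : Fin n → ℝ := fun k => ‖gelfandStarTransform B' (ι (c k).unop)‖
  refine ⟨∑ k, K k, Finset.sum_nonneg fun k _ => norm_nonneg _, fun p q hpq => ?_⟩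
  change ‖p b - q b‖ ≤ (∑ k, K k) * ∑ k, ‖p (s k) - q (s k)‖
  have hqp : ∀ d, q (ι d) = p (ι d) := fun d => (DFunLike.congr_fun hpq d).symm
  -- The coefficients come from `B`, so they take equal values at `p` and `q`; only the generators
  -- vary.
  have e : p b - q b = ∑ k, (p (s k) - q (s k)) * p (ι (c k).unop) := by
    rw [← hc', map_sum, map_sum, ← Finset.sum_sub_distrib]
    exact Finset.sum_congr rfl fun k _ => by rw [map_mul, map_mul, hqp, sub_mul]
  rw [e, Finset.mul_sum]
  refine norm_sum_le_of_le _ fun k _ => ?_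
  rw [norm_mul, _root_.mul_comm]
  gcongr
  exact ((gelfandStarTransform B' (ι (c k).unop)).norm_coe_le_norm p).trans
    (Finset.single_le_sum (f := K) (fun k _ => norm_nonneg _) (Finset.mem_univ k))

end UnitalCovering

/-- A continuous map that pulls functions vanishing at infinity back to such functions is proper. -/
theorem isProperMap_of_pullback {X : Type u} {X' : Type v} [TopologicalSpace X]
    [TopologicalSpace X'] [T2Space X] [LocallyCompactSpace X] {π : X' → X}
    (hπ : Continuous π) (h : ∀ f : C₀(X, ℂ), Tendsto (fun x => f (π x)) (cocompact X') (𝓝 0)) :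
    IsProperMap π := by
  refine isProperMap_iff_isCompact_preimage.2 ⟨hπ, fun K hK => ?_⟩
  obtain ⟨f, hf, -⟩ := exists_zeroAtInfty_eqOn_one_eqOn_zero hK isClosed_empty
    (Set.disjoint_empty _)
  obtain ⟨L, hL, hLs⟩ := mem_cocompact.1 ((Metric.tendsto_nhds.1 (h f)) 1 one_pos)
  refine hL.of_isClosed_subset (hK.isClosed.preimage hπ) fun x hx => ?_
  by_contra hxL
  have : dist (f (π x)) 0 < 1 := hLs hxL
  rw [hf _ hx] at this
  simp at this

theorem isRegular_of_isUnitalNCFiniteFoldCovering {X : Type u} {X' : Type v} [TopologicalSpace X]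
    [TopologicalSpace X'] [T2Space X] [T2Space X'] [LocallyCompactSpace X] [LocallyCompactSpace X']
    {π : X' → X} (hπ : Continuous π) (hsurj : Function.Surjective π)
    {φ : C₀(X, ℂ) →⋆ₙₐ[ℂ] C₀(X', ℂ)} (hφ : ∀ f x, φ f x = f (π x)) {G : Type v} [Group G]
    {B : Type u} {B' : Type v} [CommCStarAlgebra B] [CommCStarAlgebra B']
    {j : C₀(X, ℂ) →⋆ₙₐ[ℂ] B} {j' : C₀(X', ℂ) →⋆ₙₐ[ℂ] B'} {ι : B →⋆ₐ[ℂ] B'}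
    {ρ : G →* (B' ≃⋆ₐ[ℂ] B')} (hcomm : ∀ a, ι (j a) = j' (φ a))
    (hj : IsEssentialIdealInclusion j) (hj' : IsEssentialIdealInclusion j')
    (hcov : IsUnitalNCFiniteFoldCovering ι ρ)
    (hG : ∀ g : G, ρ g '' Set.range j' = Set.range j') :
    IsRegularFiniteFoldCoveringWithCompactification π := by
  have := hcov.finite
  let πbar := CharacterSpace.compContinuousMap ι
  let T : G → characterSpace ℂ B' ≃ₜ characterSpace ℂ B' := fun g => characterSpaceHomeomorph (ρ g)
  let e := hj.boundaryMap
  let e' := hj'.boundaryMap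
  have hT : ∀ χ ψ, πbar χ = πbar ψ ↔ ∃ g, T g χ = ψ := hcov.compContinuousMap_eq_iff
  have he : IsEmbedding e := hj.isEmbedding_boundaryMap
  have he' : IsEmbedding e' := hj'.isEmbedding_boundaryMap
  have hbar : ∀ x, πbar (e' x) = e (π x) := by
    intro x
    refine CharacterSpace.ext fun b => ?_
    obtain ⟨a, ha⟩ := exists_zeroAtInfty_apply_eq_one (π x)
    obtain ⟨c, hc⟩ := hj.mul_mem_left b a
    have h1 := hj.boundaryMap_mul (π x) hc
    have h2 := hj'.boundaryMap_mul x (b := ι b) (a := φ a) (c := φ c) (by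
      rw [← hcomm, ← hcomm, hc, map_mul])
    rw [hφ, hφ, ha, mul_one] at h2
    rw [ha, mul_one] at h1
    exact h2.trans h1.symm
  have hbar_closed : IsClosedMap πbar := πbar.continuous.isClosedMap
  have hbar_surj : Function.Surjective πbar := by
    rw [← Set.range_eq_univ, ← hbar_closed.isClosed_range.closure_eq, ← dense_iff_closure_eq]
    refine hj.denseRange_boundaryMap.mono ?_
    rintro _ ⟨x, rfl⟩
    obtain ⟨y, rfl⟩ := hsurj x
    exact ⟨e' y, hbar y⟩
  have hbar_inj : IsLocallyInjective πbar := hcov.isLocallyInjective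
  -- Characters outside `X'` vanish on the ideal `C₀(X')`. As `G` preserves this ideal, it cannot
  -- move a point of `X'` out of `X'`.
  have hact : ∀ g x, ∃ y, e' y = T g (e' x) := by
    intro g x
    by_contra hx
    obtain ⟨f, hf⟩ := exists_zeroAtInfty_apply_eq_one x
    obtain ⟨_, ⟨f', rfl⟩, hf'⟩ : j' f ∈ ρ g '' Set.range j' := by
      rw [hG g]
      exact ⟨f, rfl⟩
    have h0 : T g (e' x) (j' f') = 0 := hj'.apply_eq_zero_of_notMem_range hx f'
    have h1 : e' x (ρ g (j' f')) = 0 := h0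
    rw [hf', hj'.boundaryMap_apply, hf] at h1
    exact one_ne_zero h1
  choose t ht using hact
  have hTinv : ∀ g χ, T g (T g⁻¹ χ) = χ := fun g χ => CharacterSpace.ext fun b => by
    simp only [T, characterSpaceHomeomorph_apply, map_inv]
    exact congrArg χ ((ρ g).symm_apply_apply b)
  have ht_inv : ∀ g x, t g (t g⁻¹ x) = x := fun g x => he'.injective <| by rw [ht, ht, hTinv]
  have ht_cont : ∀ g, Continuous (t g) := fun g => he'.continuous_iff.2 <| by
    simpa only [Function.comp_def, ht] using (T g).continuous.comp he'.continuous
  let S : G → X' ≃ₜ X' := fun g =>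
    { toFun := t g
      invFun := t g⁻¹
      left_inv x := by simpa using ht_inv g⁻¹ x
      right_inv := ht_inv g
      continuous_toFun := ht_cont g
      continuous_invFun := ht_cont g⁻¹ }
  have hS : ∀ x y, π x = π y ↔ ∃ g, S g x = y := fun x y => by
    rw [← he.injective.eq_iff, ← hbar, ← hbar, hT]
    refine exists_congr fun g => ?_
    rw [← ht, he'.injective.eq_iff]
    rfl
  have hclosed : IsClosedMap π :=
    (isProperMap_of_pullback hπ fun f => by
      simpa only [hφ] using (φ f).zero_at_infty'.congr fun x => hφ f x).isClosedMap
  have hinj : IsLocallyInjective π := by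
    intro x
    obtain ⟨U, hU, hx, hinj⟩ := hbar_inj (e' x)
    refine ⟨e' ⁻¹' U, hU.preimage he'.continuous, hx, fun p hp q hq hpq => ?_⟩
    exact he'.injective (hinj hp hq (by rw [hbar, hbar, hpq]))
  refine ⟨⟨hclosed.isCoveringMap_of_orbits hS hπ hsurj hinj, characterSpace ℂ B, inferInstance,
    characterSpace ℂ B', inferInstance, e, e', πbar, hj.isCompactification_boundaryMap,
    hj'.isCompactification_boundaryMap,
    hbar_closed.isCoveringMap_of_orbits hT πbar.continuous hbar_surj hbar_inj, hbar⟩,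
    finite_preimage_singleton_of_orbits hS, ?_⟩
  -- Precomposition reverses products, so `T` and `S` are antihomomorphisms; the range of `S` is
  -- still a subgroup.
  have hTmul : ∀ g k χ, T (k * g) χ = T g (T k χ) := fun g k χ => CharacterSpace.ext fun b => by
    simp only [T, characterSpaceHomeomorph_apply, map_mul]
    rfl
  refine ⟨{ carrier := Set.range S
            mul_mem' := ?_
            one_mem' := ⟨1, ?_⟩
            inv_mem' := ?_ }, ?_, (Set.finite_range S).to_subtype, fun x y hxy => ?_⟩
  · rintro _ _ ⟨g, rfl⟩ ⟨k, rfl⟩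
    refine ⟨k * g, Homeomorph.ext fun x => he'.injective ?_⟩
    change e' (t (k * g) x) = e' (t g (t k x))
    rw [ht, ht, ht, hTmul]
  · refine Homeomorph.ext fun x => he'.injective ?_
    change e' (t 1 x) = e' x
    rw [ht]
    exact CharacterSpace.ext fun b => by
      simp only [T, characterSpaceHomeomorph_apply, map_one]
      rfl
  · rintro _ ⟨g, rfl⟩
    exact ⟨g⁻¹, Homeomorph.ext fun x => rfl⟩
  · rintro _ ⟨g, rfl⟩ x
    exact ((hS _ _).2 ⟨g, rfl⟩).symm
  · obtain ⟨g, hg⟩ := (hS x y).1 hxy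
    exact ⟨S g, ⟨g, rfl⟩, hg⟩

theorem isRegular_of_isNCFiniteFoldCovering {X : Type u} {X' : Type v} [TopologicalSpace X]
    [TopologicalSpace X'] [T2Space X] [T2Space X'] [LocallyCompactSpace X] [LocallyCompactSpace X']
    {π : X' → X} (hπ : Continuous π) (hsurj : Function.Surjective π)
    {φ : C₀(X, ℂ) →⋆ₙₐ[ℂ] C₀(X', ℂ)} (hφ : ∀ f x, φ f x = f (π x)) {G : Type v} [Group G]
    (h : IsNCFiniteFoldCoveringWithCompactification φ G) :
    IsRegularFiniteFoldCoveringWithCompactification π := by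
  obtain ⟨-, B, iB, B', iB', j, j', ι, ρ, hcomm, hj, hj', -, hcov, hG⟩ := h
  let : CommCStarAlgebra B := { iB with mul_comm := hj.mul_comm mul_comm }
  let : CommCStarAlgebra B' := { iB' with mul_comm := hj'.mul_comm mul_comm }
  exact isRegular_of_isUnitalNCFiniteFoldCovering hπ hsurj hφ hcomm hj hj' hcov hG

theorem lemma4p1 {X : Type u} {X' : Type v} [TopologicalSpace X] [TopologicalSpace X']
    [T2Space X] [T2Space X'] [LocallyCompactSpace X] [LocallyCompactSpace X']
    (π : X' → X) (hπ : Continuous π) (hsurj : Function.Surjective π) :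
    IsRegularFiniteFoldCoveringWithCompactification π ↔
      ∃ φ : C₀(X, ℂ) →⋆ₙₐ[ℂ] C₀(X', ℂ), (∀ f x, φ f x = f (π x)) ∧
        ∃ (G : Type v) (_ : Group G), IsNCFiniteFoldCoveringWithCompactification φ G :=
  ⟨exists_isNCFiniteFoldCovering_of_isRegular hπ hsurj,
    fun ⟨_, hφ, _, _, h⟩ => isRegular_of_isNCFiniteFoldCovering hπ hsurj hφ h⟩
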